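/- Conventions. A planar h-set $N$ (with one unstable and one stable direction) is given by a homeomorphism $c_N:\mathbb R^2\to\mathbb R^2$. For instance, the parallelogram h-set $N=t(c,u,s)$, with $u,s$ linearly independent, has $c_N(p,q)=c+pu+qs$. Put $|N|=c_N([-1,1]^2)$ (support), $N^{le}=c_N(\{-1\}\times[-1,1])$ and $N^{re}=c_N(\{1\}\times[-1,1])$ (left and right edges), $N^l=c_N((-\infty,-1]\times\mathbb R)$ and $N^r=c_N([1,\infty)\times\mathbb R)$ (left and right sides). For h-sets $N,M$, a continuous map $f:\mathbb R^2\to\mathbb R^2$ and an integer $w$, put $f_c=c_M^{-1}\circ f\circ c_N$. We say that $N$ $f$-covers $M$ with degree $w$ if there are a continuous $h:[0,1]\times[-1,1]^2\to\mathbb R^2$ and a continuous $A:\mathbb R\to\mathbb R$ such that 1. $h(0,\cdot)=f_c$ on $[-1,1]^2$; 2. $h([0,1]\times(\{-1,1\}\times[-1,1]))\cap[-1,1]^2=\emptyset$; 3. $h([0,1]\times[-1,1]^2)\cap([-1,1]\times\{-1,1\})=\emptyset$; 4. $h(1,(p,q))=(A(p),0)$ for all $(p,q)\in[-1,1]^2$,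 $A(\{-1,1\})\subset\mathbb R\setminus[-1,1]$, and the Brouwer degree $\deg(A,(-1,1),0)=\tfrac12(\operatorname{sgn}A(1)-\operatorname{sgn}A(-1))$ equals $w$. We say that $N$ $f$-covers $M$ if $N$ $f$-covers $M$ with degree $w$ for some $w\ne0$. Lemma. Let $f:\mathbb R^2\to\mathbb R^2$ be continuous and let $N_1,N_2$ be planar h-sets. Assume that $f$ is injective on $|N_1|$ and that (b) either $f(N_1^{le})\subset\operatorname{int}(N_2^l)$ and $f(N_1^{re})\subset\operatorname{int}(N_2^r)$, or $f(N_1^{le})\subset\operatorname{int}(N_2^r)$ and $f(N_1^{re})\subset\operatorname{int}(N_2^l)$; (a$'$) $f(\partial|N_1|)\subset\operatorname{int}(N_2^l\cup|N_2|\cup N_2^r)$. Then $N_1$ $f$-covers $N_2$. -/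

import Mathlib

open Set

/-- The closed unit square `[-1,1] × [-1,1]`, the support of an h-set in its own coordinates. -/
def unitSq : Set (ℝ × ℝ) := Icc (-1) 1 ×ˢ Icc (-1) 1

/-- The vertical (exit) edges `{-1,1} × [-1,1]` of the unit square. -/
def unitSqMinus : Set (ℝ × ℝ) := {-1, 1} ×ˢ Icc (-1) 1

/-- The horizontal (entry) edges `[-1,1] × {-1,1}` of the unit square. -/
def unitSqPlus : Set (ℝ × ℝ) := Icc (-1) 1 ×ˢ {-1, 1}

/-- A planar h-set with one unstable (first) and one stable (second) coordinate: a homeomorphism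
`coord` of the plane, going from coordinates to the phase plane. Its support is the image of the
unit square. The parallelogram with centre `c` spanned by `u` and `s` is the case
`coord (p, q) = c + p • u + q • s`. -/
structure HSet where
  coord : (ℝ × ℝ) ≃ₜ (ℝ × ℝ)

namespace HSet

/-- The support `|N|`. -/
def support (N : HSet) : Set (ℝ × ℝ) := N.coord '' unitSq

/-- The left edge `N^{le}`. -/
def leftEdge (N : HSet) : Set (ℝ × ℝ) := N.coord '' ({-1} ×ˢ Icc (-1) 1)

/-- The right edge `N^{re}`. -/
def rightEdge (N : HSet) : Set (ℝ × ℝ) := N.coord '' ({1} ×ˢ Icc (-1) 1)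

/-- The left side `N^l`. -/
def leftSide (N : HSet) : Set (ℝ × ℝ) := N.coord '' (Iic (-1) ×ˢ univ)

/-- The right side `N^r`. -/
def rightSide (N : HSet) : Set (ℝ × ℝ) := N.coord '' (Ici 1 ×ˢ univ)

/-- The map `f` written in the coordinates of `N` (source) and `M` (target). -/
def inCoords (N M : HSet) (f : ℝ × ℝ → ℝ × ℝ) : ℝ × ℝ → ℝ × ℝ :=
  fun x => M.coord.symm (f (N.coord x))

end HSet

/-- Condition b+: left edge to the left side, right edge to the right side. -/
def CondBPlus (f : ℝ × ℝ → ℝ × ℝ) (N₁ N₂ : HSet) : Prop :=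
  f '' N₁.leftEdge ⊆ interior N₂.leftSide ∧ f '' N₁.rightEdge ⊆ interior N₂.rightSide

/-- Condition b-: left edge to the right side, right edge to the left side. -/
def CondBMinus (f : ℝ × ℝ → ℝ × ℝ) (N₁ N₂ : HSet) : Prop :=
  f '' N₁.leftEdge ⊆ interior N₂.rightSide ∧ f '' N₁.rightEdge ⊆ interior N₂.leftSide

/-- Condition b: b+ or b-. -/
def CondB (f : ℝ × ℝ → ℝ × ℝ) (N₁ N₂ : HSet) : Prop :=
  CondBPlus f N₁ N₂ ∨ CondBMinus f N₁ N₂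

/-- Condition a': the boundary of `|N₁|` is mapped into the interior of the strip of `N₂`. -/
def CondAPrime (f : ℝ × ℝ → ℝ × ℝ) (N₁ N₂ : HSet) : Prop :=
  f '' frontier N₁.support ⊆ interior (N₂.leftSide ∪ N₂.support ∪ N₂.rightSide)

/-- The Brouwer degree `deg(A, (-1,1), 0)` of a continuous `A : ℝ → ℝ` that does not vanish at
`-1` and `1`. In dimension one it is `(sgn A(1) - sgn A(-1)) / 2`; the division is exact since
both signs are `1` or `-1`. -/
noncomputable def brouwerDegreeOne (A : ℝ → ℝ) : ℤ :=
  ((SignType.sign (A 1) : ℤ) - (SignType.sign (A (-1)) : ℤ)) / 2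

/-- `N` `f`-covers `M` with degree `w`: the coordinate expression of `f` is homotopic on the unit
square to `(p, q) ↦ (A p, 0)`, where `A` maps `-1` and `1` outside `[-1,1]` and has degree `w`;
along the homotopy the exit edges miss the target square, and the square misses the entry edges
of the target. -/
def CoversWithDegree (N M : HSet) (f : ℝ × ℝ → ℝ × ℝ) (w : ℤ) : Prop :=
  ∃ (h : ℝ → ℝ × ℝ → ℝ × ℝ) (A : ℝ → ℝ),
    ContinuousOn (fun z : ℝ × (ℝ × ℝ) => h z.1 z.2) (Icc 0 1 ×ˢ unitSq) ∧
    (∀ x ∈ unitSq, h 0 x = HSet.inCoords N M f x) ∧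
    (∀ t ∈ Icc (0 : ℝ) 1, ∀ x ∈ unitSqMinus, h t x ∉ unitSq) ∧
    (∀ t ∈ Icc (0 : ℝ) 1, ∀ x ∈ unitSq, h t x ∉ unitSqPlus) ∧
    Continuous A ∧
    (∀ x ∈ unitSq, h 1 x = (A x.1, 0)) ∧
    (∀ p ∈ ({-1, 1} : Set ℝ), A p ∉ Icc (-1 : ℝ) 1) ∧
    brouwerDegreeOne A = w

/-- `N` `f`-covers `M`: it does so with some nonzero degree. -/
def Covers (N M : HSet) (f : ℝ × ℝ → ℝ × ℝ) : Prop :=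
  ∃ w : ℤ, w ≠ 0 ∧ CoversWithDegree N M f w

/-! In coordinates, the strip condition forces the whole image of the square into `openStrip`.
Otherwise an interior point `y` has its image in the complement, which contains a vertical ray from
`g y` to infinity. The boundary image misses that ray, so `g x - g y` has a continuous logarithm on
the boundary. Injectivity deforms this displacement, without zeros, to the odd map `g (x/2) - g
(-x/2)`, which has none (`not_exists_continuous_log_sub_of_injOn`). Once the image lies in
`openStrip`, flattening the second coordinate and then interpolating the first gives the covering
homotopy. -/

/-! ### Continuous logarithms and injectivity -/

/-- A continuous nowhere vanishing function which is odd with respect to an involution of a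
connected space has no continuous logarithm. -/
theorem not_exists_continuous_log_of_odd {X : Type*} [TopologicalSpace X] [PreconnectedSpace X]
    [Nonempty X] {ν : X → X} (hν : Continuous ν) (hνν : Function.Involutive ν) {F : X → ℂ}
    (hodd : ∀ x, F (ν x) = -F x) :
    ¬ ∃ φ : X → ℂ, Continuous φ ∧ ∀ x, Complex.exp (φ x) = F x := by
  rintro ⟨φ, hφ, hexp⟩
  have hd : ∀ x, Complex.exp (φ (ν x) - φ x) = -1 := fun x => by
    rw [Complex.exp_sub, hexp, hexp, hodd, neg_div, div_self]
    rw [← hexp]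
    exact Complex.exp_ne_zero _
  obtain ⟨x⟩ := ‹Nonempty X›
  -- The difference `φ ∘ ν - φ` lifts the constant `-1` through `exp`, so it is constant; since `ν`
  -- also negates it, it is zero.
  have hconst : φ (ν (ν x)) - φ (ν x) = φ (ν x) - φ x :=
    Complex.isCoveringMap_exp.const_of_comp (g := fun x => φ (ν x) - φ x) (by fun_prop)
      (fun a b => Subtype.ext ((hd a).trans (hd b).symm)) (ν x) x
  rw [hνν x] at hconst
  have h0 : φ (ν x) - φ x = 0 := by linear_combination (-1 / 2 : ℂ) * hconst
  have h1 := hd x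
  rw [h0, Complex.exp_zero] at h1
  norm_num at h1

/-- Having a continuous logarithm is invariant under homotopies of nowhere vanishing functions. -/
theorem exists_continuous_log_of_homotopy {X : Type*} [TopologicalSpace X]
    {H : unitInterval × X → ℂ} (hH : Continuous H) (hne : ∀ z, H z ≠ 0)
    (h0 : ∃ φ : X → ℂ, Continuous φ ∧ ∀ x, Complex.exp (φ x) = H (0, x)) :
    ∃ φ : X → ℂ, Continuous φ ∧ ∀ x, Complex.exp (φ x) = H (1, x) := by
  obtain ⟨φ, hφ, hexp⟩ := h0
  let K : C(unitInterval × X, {z : ℂ // z ≠ 0}) := ⟨fun z => ⟨H z, hne z⟩, by fun_prop⟩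
  have hK : ∀ x, K (0, x) = ⟨Complex.exp ((⟨φ, hφ⟩ : C(X, ℂ)) x), Complex.exp_ne_zero _⟩ :=
    fun x => Subtype.ext (hexp x).symm
  refine ⟨fun x => Complex.isCoveringMap_exp.liftHomotopy K ⟨φ, hφ⟩ hK (1, x), by fun_prop,
    fun x => ?_⟩
  exact congrArg Subtype.val
    (congrFun (Complex.isCoveringMap_exp.liftHomotopy_lifts K ⟨φ, hφ⟩ hK) (1, x))

/-- If `g` is continuous and injective on the closed unit ball, then the displacement from the
image of an interior point to the image of the unit sphere has no continuous logarithm. -/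
theorem not_exists_continuous_log_sub_of_injOn {E : Type*} [NormedAddCommGroup E] [NormedSpace ℝ E]
    (hrank : 1 < Module.rank ℝ E) {g : E → ℂ} (hg : ContinuousOn g (Metric.closedBall 0 1))
    (hinj : InjOn g (Metric.closedBall 0 1)) {y : E} (hy : y ∈ Metric.ball (0 : E) 1) :
    ¬ ∃ φ : Metric.sphere (0 : E) 1 → ℂ, Continuous φ ∧
      ∀ x, Complex.exp (φ x) = g x - g y := by
  intro hlog
  have hy1 : ‖y‖ < 1 := by simpa using hy
  -- The pair `(a, b)` moves from `(x, y)` to `(x/2, -x/2)` inside the ball. It never collides: `a -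
  -- b = x - (1 - t) • y` and `‖y‖ < 1 = ‖x‖`.
  let a : unitInterval × Metric.sphere (0 : E) 1 → E := fun z => (1 - (z.1 : ℝ) / 2) • (z.2 : E)
  let b : unitInterval × Metric.sphere (0 : E) 1 → E :=
    fun z => (1 - (z.1 : ℝ)) • y - ((z.1 : ℝ) / 2) • (z.2 : E)
  have hnorm : ∀ x : Metric.sphere (0 : E) 1, ‖(x : E)‖ = 1 := fun x => by simp
  have ha : ∀ z, a z ∈ Metric.closedBall (0 : E) 1 := by
    rintro ⟨t, x⟩
    have h0 := t.2.1
    have h1 := t.2.2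
    rw [mem_closedBall_zero_iff, norm_smul, hnorm, mul_one, Real.norm_eq_abs,
      abs_of_nonneg (by linarith)]
    linarith
  have hb : ∀ z, b z ∈ Metric.closedBall (0 : E) 1 := by
    rintro ⟨t, x⟩
    have h0 := t.2.1
    have h1 := t.2.2
    rw [mem_closedBall_zero_iff]
    refine (norm_sub_le _ _).trans ?_
    rw [norm_smul, norm_smul, hnorm, mul_one, Real.norm_eq_abs, Real.norm_eq_abs,
      abs_of_nonneg (by linarith), abs_of_nonneg (by linarith)]
    nlinarith
  have hab : ∀ z, g (a z) - g (b z) ≠ 0 := by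
    rintro ⟨t, x⟩ h
    have h0 := t.2.1
    have h1 := t.2.2
    have heq : a (t, x) = b (t, x) := hinj (ha _) (hb _) (sub_eq_zero.1 h)
    have hx : (x : E) = (1 - (t : ℝ)) • y := by
      have : (x : E) - (1 - (t : ℝ)) • y = a (t, x) - b (t, x) := by
        simp only [a, b]
        module
      rwa [heq, sub_self, sub_eq_zero] at this
    have := congrArg norm hx
    rw [hnorm, norm_smul, Real.norm_eq_abs, abs_of_nonneg (by linarith)] at this
    nlinarith [norm_nonneg y]
  have hcont : Continuous fun z => g (a z) - g (b z) :=
    (hg.comp_continuous (by fun_prop) ha).sub (hg.comp_continuous (by fun_prop) hb)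
  have hend := exists_continuous_log_of_homotopy hcont hab (by simpa [a, b] using hlog)
  have : PreconnectedSpace (Metric.sphere (0 : E) 1) :=
    isPreconnected_iff_preconnectedSpace.1 (isPreconnected_sphere hrank 0 1)
  have : Nonempty (Metric.sphere (0 : E) 1) := (isConnected_sphere hrank 0 zero_le_one).1.to_subtype
  refine not_exists_continuous_log_of_odd (ν := fun x => -x) continuous_neg neg_involutive
    (fun x => ?_) hend
  have h₁ : a (1, -x) = b (1, x) := by
    simp only [a, b, Icc.coe_one, coe_neg_sphere]
    module
  have h₂ : b (1, -x) = a (1, x) := by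
    simp only [a, b, Icc.coe_one, coe_neg_sphere]
    module
  rw [h₁, h₂, neg_sub]

/-! ### Confinement to the strip -/

theorem unitSq_eq_closedBall : unitSq = Metric.closedBall (0 : ℝ × ℝ) 1 := by
  ext ⟨p, q⟩
  simp only [unitSq, mem_prod, mem_Icc, mem_closedBall_zero_iff, Prod.norm_def, Real.norm_eq_abs,
    max_le_iff, abs_le]

theorem frontier_unitSq : frontier unitSq = Metric.sphere (0 : ℝ × ℝ) 1 := by
  rw [unitSq_eq_closedBall, frontier_closedBall _ one_ne_zero]

/-- The open horizontal strip around the unit square together with the two open half planes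
`|p| > 1`. -/
def openStrip : Set (ℝ × ℝ) := {x | 1 < |x.1| ∨ |x.2| < 1}

/-- A map which is continuous and injective on the unit square and maps its boundary into
`openStrip` maps the whole square there. -/
theorem mapsTo_openStrip {g : ℝ × ℝ → ℝ × ℝ} (hg : ContinuousOn g unitSq)
    (hinj : InjOn g unitSq) (hbd : MapsTo g (frontier unitSq) openStrip) :
    MapsTo g unitSq openStrip := by
  intro y hy
  by_contra hout
  simp only [openStrip, mem_ofPred_eq, not_or, not_lt] at hout
  obtain ⟨hout1, hout2⟩ := hout
  have hball : y ∈ Metric.ball (0 : ℝ × ℝ) 1 := by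
    rw [unitSq_eq_closedBall, mem_closedBall_zero_iff] at hy
    rw [mem_ball_zero_iff]
    refine lt_of_le_of_ne hy fun h => ?_
    have := hbd (x := y) (by rw [frontier_unitSq]; simpa using h)
    simp only [openStrip, mem_ofPred_eq] at this
    rcases this with h | h <;> linarith
  rw [unitSq_eq_closedBall] at hg hinj
  rw [frontier_unitSq] at hbd
  have hrank : 1 < Module.rank ℝ (ℝ × ℝ) := by
    rw [rank_prod', Module.rank_self]
    norm_num
  let G : ℝ × ℝ → ℂ := fun x => Complex.equivRealProdCLM.symm (g x)
  have hG : ContinuousOn G (Metric.closedBall 0 1) :=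
    Complex.equivRealProdCLM.symm.continuous.comp_continuousOn hg
  refine not_exists_continuous_log_sub_of_injOn hrank hG
    (Complex.equivRealProdCLM.symm.injective.comp_injOn hinj) hball ?_
  have hGc : Continuous fun x : Metric.sphere (0 : ℝ × ℝ) 1 => G x :=
    hG.comp_continuous continuous_subtype_val fun x => Metric.sphere_subset_closedBall x.2
  have hre : ∀ x, (G x).re = (g x).1 := fun x => by simp [G]
  have him : ∀ x, (G x).im = (g x).2 := fun x => by simp [G]
  /- Multiplication by `c` turns the vertical ray from `g y` to infinity into the negative axis. -/
  obtain ⟨c, hc0, hc⟩ : ∃ c : ℂ, c ≠ 0 ∧ ∀ x : Metric.sphere (0 : ℝ × ℝ) 1,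
      c * (G x - G y) ∈ Complex.slitPlane := by
    -- The ray goes up or down according to the sign of `(g y).2`; along it the first coordinate
    -- stays in `[-1,1]` and the second keeps absolute value at least `1`.
    rcases le_abs.1 hout2 with h2 | h2
    · refine ⟨Complex.I, Complex.I_ne_zero, fun x => ?_⟩
      by_contra hx
      rw [Complex.mem_slitPlane_iff, not_or, not_lt, not_not] at hx
      simp only [Complex.mul_re, Complex.mul_im, Complex.I_re, Complex.I_im, Complex.sub_re,
        Complex.sub_im, hre, him] at hx
      have h1 : (g x).1 = (g y).1 := by linarith [hx.2]
      rcases hbd x.2 with h | h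
      · rw [h1] at h; linarith
      · linarith [(abs_lt.1 h).2, hx.1]
    · refine ⟨-Complex.I, neg_ne_zero.2 Complex.I_ne_zero, fun x => ?_⟩
      by_contra hx
      rw [Complex.mem_slitPlane_iff, not_or, not_lt, not_not] at hx
      simp only [Complex.mul_re, Complex.mul_im, Complex.neg_re, Complex.neg_im, Complex.I_re,
        Complex.I_im, Complex.sub_re, Complex.sub_im, hre, him] at hx
      have h1 : (g x).1 = (g y).1 := by linarith [hx.2]
      rcases hbd x.2 with h | h
      · rw [h1] at h; linarith
      · linarith [(abs_lt.1 h).1, hx.1]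
  refine ⟨fun x => Complex.log (c * (G x - G y)) - Complex.log c,
    ((continuous_const.mul (hGc.sub continuous_const)).clog hc).sub continuous_const, fun x => ?_⟩
  rw [Complex.exp_sub, Complex.exp_log (Complex.slitPlane_ne_zero (hc x)), Complex.exp_log hc0,
    mul_div_cancel_left₀ _ hc0]

theorem interior_strip_subset_openStrip :
    interior ((Iic (-1) ×ˢ univ) ∪ unitSq ∪ (Ici 1 ×ˢ univ) : Set (ℝ × ℝ)) ⊆ openStrip := by
  rintro ⟨p, q⟩ hpq
  by_contra hout
  simp only [openStrip, mem_ofPred_eq, not_or, not_lt] at hout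
  obtain ⟨h1, h2⟩ := hout
  -- For small `t > 0` this path leaves the closed strip, even from a corner or a vertical boundary
  -- ray.
  have hcont : Continuous fun t : ℝ => (p * (1 - t), q * (1 + t)) := by fun_prop
  have hev := hcont.continuousAt.eventually
    (show ∀ᶠ x in nhds (p * (1 - 0), q * (1 + 0)),
      x ∈ ((Iic (-1) ×ˢ univ) ∪ unitSq ∪ (Ici 1 ×ˢ univ) : Set (ℝ × ℝ)) by
        rw [sub_zero, add_zero, mul_one, mul_one]
        exact mem_interior_iff_mem_nhds.1 hpq)
  obtain ⟨t, hmem, ht0, ht1⟩ := ((hev.filter_mono nhdsWithin_le_nhds).and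
    (Ioo_mem_nhdsGT (zero_lt_one (α := ℝ)))).exists
  have h1' : |p * (1 - t)| < 1 := by
    rw [abs_mul, abs_of_pos (by linarith : 0 < 1 - t)]
    nlinarith [abs_nonneg p]
  have h2' : 1 < |q * (1 + t)| := by
    rw [abs_mul, abs_of_pos (by linarith : 0 < 1 + t)]
    nlinarith
  rw [abs_lt] at h1'
  rcases hmem with (h | h) | h
  · linarith [mem_Iic.1 h.1]
  · linarith [abs_le.2 (mem_Icc.1 h.2)]
  · linarith [mem_Ici.1 h.1]

namespace HSet

theorem mem_interior_leftSide {N : HSet} {x : ℝ × ℝ} :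
    x ∈ interior N.leftSide ↔ (N.coord.symm x).1 < -1 := by
  rw [leftSide, ← N.coord.image_interior, interior_prod_eq, interior_Iic, interior_univ,
    ← N.coord.preimage_symm]
  simp

theorem mem_interior_rightSide {N : HSet} {x : ℝ × ℝ} :
    x ∈ interior N.rightSide ↔ 1 < (N.coord.symm x).1 := by
  rw [rightSide, ← N.coord.image_interior, interior_prod_eq, interior_Ici, interior_univ,
    ← N.coord.preimage_symm]
  simp

theorem coord_symm_mem_openStrip {N : HSet} {x : ℝ × ℝ}
    (hx : x ∈ interior (N.leftSide ∪ N.support ∪ N.rightSide)) :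
    N.coord.symm x ∈ openStrip := by
  rw [leftSide, support, rightSide, ← image_union, ← image_union, ← N.coord.image_interior,
    ← N.coord.preimage_symm] at hx
  exact interior_strip_subset_openStrip hx

end HSet

/-! ### The covering homotopy -/

/-- A map of the unit square into `openStrip` which moves the exit edges across the target square,
in the direction given by `ε`, is homotopic to the linear model `(p, q) ↦ (2 * ε * p, 0)`. -/
theorem coversWithDegree_of_mapsTo_openStrip {N M : HSet} {f : ℝ × ℝ → ℝ × ℝ}
    (hf : Continuous f) (hstrip : MapsTo (HSet.inCoords N M f) unitSq openStrip) {ε : ℝ}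
    (hε : |ε| = 1)
    (hexit : ∀ x ∈ unitSqMinus, 1 < ε * x.1 * (HSet.inCoords N M f x).1) :
    CoversWithDegree N M f (brouwerDegreeOne fun p => 2 * ε * p) := by
  have hg : Continuous (HSet.inCoords N M f) :=
    M.coord.symm.continuous.comp (hf.comp N.coord.continuous)
  set g := HSet.inCoords N M f
  have hεε : ε * ε = 1 := by rw [← abs_mul_abs_self, hε, one_mul]
  -- Up to `t = 1/2` only the second coordinate shrinks, to `0`; afterwards only the first moves.
  refine ⟨fun t x => ((1 - max 0 (2 * t - 1)) * (g x).1 + max 0 (2 * t - 1) * (2 * ε * x.1),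
    max 0 (1 - 2 * t) * (g x).2), fun p => 2 * ε * p, by fun_prop, fun x _ => ?_, ?_, ?_,
    by fun_prop, fun x _ => ?_, ?_, rfl⟩
  · norm_num [g]
  · rintro t ⟨ht0, ht1⟩ x hx hmem
    have hs0 : 0 ≤ max 0 (2 * t - 1) := le_max_left _ _
    have hs1 : max 0 (2 * t - 1) ≤ 1 := max_le zero_le_one (by linarith)
    have hx1 : x.1 * x.1 = 1 := by
      rcases hx.1 with h | h
      · rw [h]; norm_num
      · rw [mem_singleton_iff.1 h]; norm_num
    -- On exit edges, `ε * x.1 = ±1` times the first coordinate is a convex combination of a number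
    -- above `1` and `2`.
    have hmodel : ε * x.1 * (2 * ε * x.1) = 2 := by
      linear_combination 2 * (x.1 * x.1) * hεε + 2 * hx1
    have habs : |ε * x.1| = 1 := by
      rw [abs_mul, hε, one_mul, ← pow_eq_one_iff_of_nonneg (abs_nonneg _) two_ne_zero, sq_abs, sq,
        hx1]
    have hle := (le_abs_self _).trans_eq
      (abs_mul (ε * x.1) ((1 - max 0 (2 * t - 1)) * (g x).1 + max 0 (2 * t - 1) * (2 * ε * x.1)))
    rw [habs, one_mul] at hle
    have hle' := hle.trans (abs_le.2 hmem.1)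
    rw [mul_add, mul_left_comm, mul_left_comm (ε * x.1) (max 0 _), hmodel] at hle'
    rcases hs0.eq_or_lt with h | h
    · rw [← h] at hle'
      linarith [hexit x hx]
    · nlinarith [hexit x hx]
  · rintro t ⟨ht0, ht1⟩ x hx ⟨hmem1, hmem2⟩
    simp only [mem_insert_iff, mem_singleton_iff] at hmem2
    have hr0 : 0 ≤ max 0 (1 - 2 * t) := le_max_left _ _
    have hr1 : max 0 (1 - 2 * t) ≤ 1 := max_le zero_le_one (by linarith)
    have habs : max 0 (1 - 2 * t) * |(g x).2| = 1 := by
      rw [← abs_of_nonneg hr0, ← abs_mul]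
      rcases hmem2 with h | h <;> rw [h] <;> norm_num
    have ht : 2 * t - 1 ≤ 0 := by
      by_contra h
      rw [max_eq_left (by linarith), zero_mul] at habs
      exact zero_ne_one habs
    simp only [max_eq_left ht, sub_zero, one_mul, zero_mul, add_zero] at hmem1
    rcases hstrip hx with h | h
    · linarith [abs_le.2 (mem_Icc.1 hmem1)]
    · nlinarith [abs_nonneg (g x).2]
  · norm_num
  · intro p hp hmem
    have hp1 : |p| = 1 := by
      rcases hp with h | h
      · rw [h]; norm_num
      · rw [mem_singleton_iff.1 h]; norm_num
    have := abs_le.2 (mem_Icc.1 hmem)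
    rw [abs_mul, abs_mul, hε, hp1] at this
    norm_num at this

theorem brouwerDegreeOne_linear {a : ℝ} : brouwerDegreeOne (fun p => a * p) = SignType.sign a := by
  unfold brouwerDegreeOne
  rcases lt_trichotomy a 0 with h | h | h <;> simp [h]

theorem mainTheorem2 (f : ℝ × ℝ → ℝ × ℝ) (hf : Continuous f) (N₁ N₂ : HSet)
    (hinj : Set.InjOn f N₁.support) (hb : CondB f N₁ N₂) (ha : CondAPrime f N₁ N₂) :
    Covers N₁ N₂ f := by
  have hg : Continuous (HSet.inCoords N₁ N₂ f) :=
    N₂.coord.symm.continuous.comp (hf.comp N₁.coord.continuous)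
  have hstrip : MapsTo (HSet.inCoords N₁ N₂ f) unitSq openStrip := by
    refine mapsTo_openStrip hg.continuousOn (fun x hx y hy hxy => ?_) fun x hx => ?_
    · exact N₁.coord.injective (hinj (mem_image_of_mem _ hx) (mem_image_of_mem _ hy)
        (N₂.coord.symm.injective hxy))
    · refine HSet.coord_symm_mem_openStrip (ha (mem_image_of_mem f ?_))
      rw [HSet.support, ← N₁.coord.image_frontier]
      exact mem_image_of_mem _ hx
  have hleft : ∀ q ∈ Icc (-1 : ℝ) 1, f (N₁.coord (-1, q)) ∈ f '' N₁.leftEdge := fun q hq =>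
    mem_image_of_mem _ (mem_image_of_mem _ ⟨rfl, hq⟩)
  have hright : ∀ q ∈ Icc (-1 : ℝ) 1, f (N₁.coord (1, q)) ∈ f '' N₁.rightEdge := fun q hq =>
    mem_image_of_mem _ (mem_image_of_mem _ ⟨rfl, hq⟩)
  -- The sign `ε` records whether the edges keep or swap sides, and is the degree.
  rcases hb with ⟨hl, hr⟩ | ⟨hl, hr⟩
  · refine ⟨_, ?_, coversWithDegree_of_mapsTo_openStrip hf hstrip (ε := 1) (by norm_num) ?_⟩
    · rw [brouwerDegreeOne_linear]
      norm_num
    · rintro ⟨p, q⟩ ⟨rfl | rfl, hq⟩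
      · have : (HSet.inCoords N₁ N₂ f (-1, q)).1 < -1 :=
          HSet.mem_interior_leftSide.1 (hl (hleft q hq))
        dsimp only
        linarith
      · have : 1 < (HSet.inCoords N₁ N₂ f (1, q)).1 :=
          HSet.mem_interior_rightSide.1 (hr (hright q hq))
        dsimp only
        linarith
  · refine ⟨_, ?_, coversWithDegree_of_mapsTo_openStrip hf hstrip (ε := -1) (by norm_num) ?_⟩
    · rw [brouwerDegreeOne_linear]
      norm_num
    · rintro ⟨p, q⟩ ⟨rfl | rfl, hq⟩
      · have : 1 < (HSet.inCoords N₁ N₂ f (-1, q)).1 :=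
          HSet.mem_interior_rightSide.1 (hl (hleft q hq))
        dsimp only
        linarith
      · have : (HSet.inCoords N₁ N₂ f (1, q)).1 < -1 :=
          HSet.mem_interior_leftSide.1 (hr (hright q hq))
        dsimp only
        linarith
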